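/- Let $\Bbbk$ be a field of characteristic zero, let $n \ge 5$ be an odd integer, and let $S = \Bbbk[x_1,\ldots,x_n]$ with the standard grading. Let $I \subset S$ be an ideal that is minimally generated by $n+2$ monomials of degree $2$ and such that the quotient $A = S/I = \bigoplus_{i \ge 0} A_i$ is artinian. Then $A$ has the weak Lefschetz property (WLP): there is a linear form $\ell \in A_1$ such that for every $i \ge 0$ the multiplication map $\times \ell : A_i \to A_{i+1}$ is injective or surjective. -/

import Mathlib

open MvPolynomial

noncomputable section

/-- The graded piece of degree `i` of `k[x_1, …, x_n] / I`, for a homogeneous ideal `I` and the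
standard grading: the classes of the homogeneous polynomials of degree `i`. -/
def quotPiece {k : Type*} [Field k] {n : ℕ} (I : Ideal (MvPolynomial (Fin n) k)) (i : ℕ) :
    Submodule k (MvPolynomial (Fin n) k ⧸ I) :=
  (homogeneousSubmodule (Fin n) k i).map (Ideal.Quotient.mkₐ k I).toLinearMap

theorem quotPiece_mul_mem {k : Type*} [Field k] {n : ℕ} {I : Ideal (MvPolynomial (Fin n) k)}
    {i : ℕ} {l a : MvPolynomial (Fin n) k ⧸ I} (hl : l ∈ quotPiece I 1) (ha : a ∈ quotPiece I i) :
    l * a ∈ quotPiece I (i + 1) := by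
  obtain ⟨p, hp, rfl⟩ := hl
  obtain ⟨q, hq, rfl⟩ := ha
  refine ⟨p * q, ?_, map_mul (Ideal.Quotient.mkₐ k I) p q⟩
  have h : (p * q).IsHomogeneous (1 + i) := IsHomogeneous.mul hp hq
  rw [add_comm] at h
  exact h

/-- Multiplication by a linear form `l`, as a `k`-linear map from the piece of degree `i` to the
piece of degree `i + 1`. -/
def mulLinearForm {k : Type*} [Field k] {n : ℕ} (I : Ideal (MvPolynomial (Fin n) k))
    (l : MvPolynomial (Fin n) k ⧸ I) (hl : l ∈ quotPiece I 1) (i : ℕ) :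
    quotPiece I i →ₗ[k] quotPiece I (i + 1) :=
  (LinearMap.mulLeft k l).restrict fun _ ha => quotPiece_mul_mem hl ha

/-- The weak Lefschetz property of `k[x_1, …, x_n] / I`, for a homogeneous ideal `I`: there is a
linear form such that multiplication by it has maximal rank in every degree, that is, each map
from the piece of degree `i` to the piece of degree `i + 1` is injective or surjective. -/
def HasWLP {k : Type*} [Field k] {n : ℕ} (I : Ideal (MvPolynomial (Fin n) k)) : Prop :=
  ∃ (l : MvPolynomial (Fin n) k ⧸ I) (hl : l ∈ quotPiece I 1), ∀ i : ℕ,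
    Function.Injective (mulLinearForm I l hl i) ∨ Function.Surjective (mulLinearForm I l hl i)

/-- The ideal generated by the monomials with exponent vectors in `G`. -/
def monomialIdeal (k : Type*) [Field k] {n : ℕ} (G : Finset (Fin n →₀ ℕ)) :
    Ideal (MvPolynomial (Fin n) k) :=
  Ideal.span ((fun m => monomial m (1 : k)) '' (G : Set (Fin n →₀ ℕ)))

/-- `I` is minimally generated by `μ` monomials of degree `d`: some set of `μ` monomials of degree
`d` generates `I`, and no proper subset of it does. -/
def IsMinGenByMonomials {k : Type*} [Field k] {n : ℕ} (I : Ideal (MvPolynomial (Fin n) k))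
    (μ d : ℕ) : Prop :=
  ∃ G : Finset (Fin n →₀ ℕ), G.card = μ ∧ (∀ m ∈ G, m.degree = d) ∧
    monomialIdeal k G = I ∧ ∀ G' : Finset (Fin n →₀ ℕ), G' ⊂ G → monomialIdeal k G' ≠ I

end

/-! Since `A` is artinian, all `n` squares of variables are among the generators, and the other two
generators are squarefree, i.e. two distinct edges `{p, q}` and `{r, s}`. So `A` has as basis the
squarefree monomials whose support contains neither edge, and multiplication by the sum of the
variables is the up operator of this family of sets (`hasWLP_of_maximalRank`).

For all subsets of a finite set `V`, the raising, lowering and weight operators form an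
`sl₂`-triple, so in characteristic zero the up operator is injective below the middle layer and
surjective above it (`upInjective_subsets`, `upSurjective_subsets`). Splitting a family at a vertex
`x` makes the up operator block triangular, with diagonal blocks the deletion and the link of `x`;
it is injective, or surjective, when both blocks are. One splitting at the shared vertex settles
edges that meet. Disjoint edges take two splittings, and the resulting ranges of injectivity and
surjectivity miss only the degree `i` with `2 * i + 2 = n`, which odd `n` excludes. -/

noncomputable section

/-! ### The `sl₂`-action on functions on the Boolean lattice. -/

section BooleanLattice

attribute [local instance] LieRing.ofAssociativeRing

variable {α k : Type*} [DecidableEq α] [Field k]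

/-- The operator on functions of finite sets that adds the element `v`. -/
def raiseAt (k : Type*) [Field k] (v : α) : Module.End k (Finset α → k) where
  toFun f S := if v ∈ S then f (S.erase v) else 0
  map_add' f g := by ext S; by_cases h : v ∈ S <;> simp [h]
  map_smul' c f := by ext S; by_cases h : v ∈ S <;> simp [h]

/-- The operator on functions of finite sets that removes the element `v`. -/
def lowerAt (k : Type*) [Field k] (v : α) : Module.End k (Finset α → k) where
  toFun f S := if v ∈ S then 0 else f (insert v S)
  map_add' f g := by ext S; by_cases h : v ∈ S <;> simp [h]
  map_smul' c f := by ext S; by_cases h : v ∈ S <;> simp [h]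

/-- The diagonal operator with value `1` on the sets containing `v` and `-1` on the others. -/
def weightAt (k : Type*) [Field k] (v : α) : Module.End k (Finset α → k) where
  toFun f S := if v ∈ S then f S else - f S
  map_add' f g := by ext S; by_cases h : v ∈ S <;> simp [h]; ring
  map_smul' c f := by ext S; by_cases h : v ∈ S <;> simp [h]

theorem raiseAt_apply (v : α) (f : Finset α → k) (S : Finset α) :
    raiseAt k v f S = if v ∈ S then f (S.erase v) else 0 := rfl

theorem lowerAt_apply (v : α) (f : Finset α → k) (S : Finset α) :
    lowerAt k v f S = if v ∈ S then 0 else f (insert v S) := rfl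

theorem weightAt_apply (v : α) (f : Finset α → k) (S : Finset α) :
    weightAt k v f S = if v ∈ S then f S else - f S := rfl

theorem lie_raiseAt_lowerAt (v w : α) :
    ⁅raiseAt k v, lowerAt k w⁆ = if v = w then weightAt k v else 0 := by
  ext1 f
  funext S
  rw [Ring.lie_def, LinearMap.sub_apply, Module.End.mul_apply, Module.End.mul_apply, Pi.sub_apply]
  split_ifs with h
  · subst h
    by_cases hv : v ∈ S <;> simp [raiseAt_apply, lowerAt_apply, weightAt_apply, hv]
  · have h' : w ≠ v := Ne.symm h
    by_cases hv : v ∈ S <;> by_cases hw : w ∈ S <;>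
      simp [raiseAt_apply, lowerAt_apply, hv, hw, h, h', Finset.erase_insert_of_ne]

theorem lie_weightAt_raiseAt (v w : α) :
    ⁅weightAt k v, raiseAt k w⁆ = if v = w then 2 • raiseAt k v else 0 := by
  ext1 f
  funext S
  rw [Ring.lie_def, LinearMap.sub_apply, Module.End.mul_apply, Module.End.mul_apply, Pi.sub_apply]
  split_ifs with h
  · subst h
    by_cases hv : v ∈ S <;> simp [raiseAt_apply, weightAt_apply, hv, two_mul]
  · by_cases hv : v ∈ S <;> by_cases hw : w ∈ S <;>
      simp [raiseAt_apply, weightAt_apply, hv, hw, h]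

theorem lie_weightAt_lowerAt (v w : α) :
    ⁅weightAt k v, lowerAt k w⁆ = if v = w then -(2 • lowerAt k v) else 0 := by
  ext1 f
  funext S
  rw [Ring.lie_def, LinearMap.sub_apply, Module.End.mul_apply, Module.End.mul_apply, Pi.sub_apply]
  split_ifs with h
  · subst h
    by_cases hv : v ∈ S <;> simp [lowerAt_apply, weightAt_apply, hv]
    ring
  · by_cases hv : v ∈ S <;> by_cases hw : w ∈ S <;>
      simp [lowerAt_apply, weightAt_apply, hv, hw, h]

/-- The sum of the raising operators at the elements of `V`. -/
def raise (k : Type*) [Field k] (V : Finset α) : Module.End k (Finset α → k) :=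
  ∑ v ∈ V, raiseAt k v

/-- The sum of the lowering operators at the elements of `V`. -/
def lower (k : Type*) [Field k] (V : Finset α) : Module.End k (Finset α → k) :=
  ∑ v ∈ V, lowerAt k v

/-- The sum of the weight operators at the elements of `V`. -/
def weight (k : Type*) [Field k] (V : Finset α) : Module.End k (Finset α → k) :=
  ∑ v ∈ V, weightAt k v

theorem raise_apply (V : Finset α) (f : Finset α → k) (S : Finset α) :
    raise k V f S = ∑ v ∈ V, if v ∈ S then f (S.erase v) else 0 := by
  simp [raise, LinearMap.sum_apply, raiseAt_apply]

theorem lower_apply (V : Finset α) (f : Finset α → k) (S : Finset α) :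
    lower k V f S = ∑ v ∈ V, if v ∈ S then 0 else f (insert v S) := by
  simp [lower, LinearMap.sum_apply, lowerAt_apply]

theorem raise_apply_of_subset {V S : Finset α} (h : S ⊆ V) (f : Finset α → k) :
    raise k V f S = ∑ v ∈ S, f (S.erase v) := by
  rw [raise_apply, ← Finset.sum_filter, Finset.filter_mem_eq_inter,
    Finset.inter_eq_right.mpr h]

/-- Each element of `V` carries its own `sl₂`-relations, and operators at different elements
commute, so in the brackets of the sums only the diagonal terms survive. -/
theorem isSl2Triple_weight_raise_lower {V : Finset α} (h : weight k V ≠ 0) :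
    IsSl2Triple (weight k V) (raise k V) (lower k V) where
  h_ne_zero := h
  lie_e_f := by
    simp only [raise, lower, weight, sum_lie, lie_sum, lie_raiseAt_lowerAt]
    refine Finset.sum_congr rfl fun v hv => ?_
    simp [hv]
  lie_h_e_nsmul := by
    simp only [raise, weight, sum_lie, lie_sum, lie_weightAt_raiseAt, Finset.smul_sum]
    refine Finset.sum_congr rfl fun v hv => ?_
    simp [hv]
  lie_h_f_nsmul := by
    simp only [lower, weight, sum_lie, lie_sum, lie_weightAt_lowerAt, Finset.smul_sum,
      ← Finset.sum_neg_distrib]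
    refine Finset.sum_congr rfl fun v hv => ?_
    simp [hv]

/-- The restriction of a function to the subsets of `V` of size `i`. -/
def layer (V : Finset α) (i : ℕ) (f : Finset α → k) (S : Finset α) : k :=
  if S ⊆ V ∧ S.card = i then f S else 0

theorem weight_layer (V : Finset α) (i : ℕ) (f : Finset α → k) :
    weight k V (layer V i f) = (2 * i - V.card : k) • layer V i f := by
  funext S
  simp only [weight, LinearMap.sum_apply, Finset.sum_apply, weightAt_apply, Pi.smul_apply,
    smul_eq_mul]
  by_cases h : S ⊆ V ∧ S.card = i
  · have hc : V.card = S.card + (V \ S).card := by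
      rw [add_comm, Finset.card_sdiff_add_card_eq_card h.1]
    rw [← Finset.sum_sdiff h.1, Finset.sum_congr rfl (fun v hv => if_neg (Finset.mem_sdiff.1 hv).2),
      Finset.sum_congr rfl (fun v hv => if_pos hv), Finset.sum_const, Finset.sum_const, hc, ← h.2]
    simp only [nsmul_eq_mul]
    push_cast
    ring
  · simp [layer, h]

theorem raise_layer_eq_zero {V : Finset α} {i : ℕ} {f : Finset α → k}
    (hf : ∀ T ⊆ V, T.card = i + 1 → ∑ v ∈ T, f (T.erase v) = 0) :
    raise k V (layer V i f) = 0 := by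
  funext T
  rw [raise_apply]
  by_cases h : T ⊆ V ∧ T.card = i + 1
  · rw [← raise_apply, raise_apply_of_subset h.1, Pi.zero_apply, ← hf T h.1 h.2]
    refine Finset.sum_congr rfl fun v hv => if_pos ⟨(T.erase_subset v).trans h.1, ?_⟩
    rw [Finset.card_erase_of_mem hv, h.2, Nat.add_sub_cancel]
  · refine Finset.sum_eq_zero fun v hv => ?_
    split_ifs with hvT
    · refine if_neg fun h' => h ⟨?_, ?_⟩
      · rw [← Finset.insert_erase hvT]
        exact Finset.insert_subset hv h'.1
      · rw [← h'.2, Finset.card_erase_add_one hvT]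
    · rfl

theorem lower_layer_eq_zero {V : Finset α} {i : ℕ} {f : Finset α → k}
    (hf : lower k V f = 0) : lower k V (layer V (i + 1) f) = 0 := by
  funext S
  by_cases h : S ⊆ V ∧ S.card = i
  · refine Eq.trans ?_ (congrFun hf S)
    rw [lower_apply, lower_apply]
    refine Finset.sum_congr rfl fun v hv => ?_
    split_ifs with hvS
    · rfl
    · exact if_pos ⟨Finset.insert_subset hv h.1, by rw [Finset.card_insert_of_notMem hvS, h.2]⟩
  · rw [lower_apply]
    refine Finset.sum_eq_zero fun v hv => ?_
    split_ifs with hvS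
    · rfl
    · refine if_neg fun h' => h ⟨(Finset.subset_insert v S).trans h'.1, ?_⟩
      have := h'.2
      rw [Finset.card_insert_of_notMem hvS] at this
      omega

variable [Fintype α] [CharZero k]

/-- A nonzero vector killed by `raise` is primitive, so its weight `2 * i - V.card` would be a
natural number, by finite dimension and characteristic zero; but it is negative. -/
theorem layer_eq_zero_of_raise_eq_zero {V : Finset α} {i : ℕ} (hi : 2 * i < V.card)
    {f : Finset α → k} (hf : raise k V (layer V i f) = 0) : layer V i f = 0 := by
  by_contra h0
  have hw := weight_layer V i f
  have hne : weight k V ≠ 0 := by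
    intro h
    rw [h, LinearMap.zero_apply, eq_comm, smul_eq_zero, or_iff_left h0, sub_eq_zero] at hw
    norm_cast at hw
    omega
  have P : (isSl2Triple_weight_raise_lower hne).HasPrimitiveVectorWith (layer V i f)
      (2 * i - V.card : k) := ⟨h0, hw, hf⟩
  obtain ⟨m, hm⟩ := P.exists_nat
  rw [sub_eq_iff_eq_add] at hm
  norm_cast at hm
  omega

theorem layer_eq_zero_of_lower_eq_zero {V : Finset α} {i : ℕ} (hi : V.card < 2 * i)
    {f : Finset α → k} (hf : lower k V (layer V i f) = 0) : layer V i f = 0 := by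
  by_contra h0
  have hw := weight_layer V i f
  have hne : weight k V ≠ 0 := by
    intro h
    rw [h, LinearMap.zero_apply, eq_comm, smul_eq_zero, or_iff_left h0, sub_eq_zero] at hw
    norm_cast at hw
    omega
  have P : (isSl2Triple_weight_raise_lower hne).symm.HasPrimitiveVectorWith (layer V i f)
      (-(2 * i - V.card) : k) :=
    ⟨h0, by rw [neg_smul, ← hw]; rfl, hf⟩
  obtain ⟨m, hm⟩ := P.exists_nat
  rw [neg_sub, sub_eq_iff_eq_add] at hm
  norm_cast at hm
  omega

/-- By duality: `lower` is the transpose of `raise`, so surjectivity onto a layer follows from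
injectivity of `lower` on that layer. -/
theorem layer_mem_range_raise {V : Finset α} {i : ℕ} (hi : V.card < 2 * (i + 1))
    (g : Finset α → k) : layer V (i + 1) g ∈ LinearMap.range (raise k V) := by
  by_contra hg
  obtain ⟨φ, hφ, hφr⟩ := Submodule.exists_dual_map_eq_bot_of_notMem hg inferInstance
  have hφr' (f : Finset α → k) : φ (raise k V f) = 0 := by
    have : φ (raise k V f) ∈ (LinearMap.range (raise k V)).map φ :=
      Submodule.mem_map_of_mem (LinearMap.mem_range_self _ f)
    simpa [hφr] using this
  -- The coordinates of `φ`; as `φ` vanishes on the range of `raise`, they are killed by the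
  -- transpose `lower`.
  set h : Finset α → k := fun S => φ (Pi.single S 1)
  have hD : lower k V h = 0 := by
    funext S
    refine Eq.trans ?_ (hφr' (Pi.single S 1))
    rw [lower_apply, raise, LinearMap.sum_apply, map_sum]
    refine Finset.sum_congr rfl fun v hvV => ?_
    split_ifs with hv
    · rw [show raiseAt k v (Pi.single S 1) = 0 from ?_, map_zero]
      funext T
      rw [raiseAt_apply]
      split_ifs with hT
      · exact Pi.single_eq_of_ne (by rintro rfl; exact Finset.notMem_erase v T hv) _
      · rfl
    · refine congrArg φ ?_
      funext T
      rw [raiseAt_apply]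
      simp only [Pi.single_apply]
      by_cases hT : v ∈ T
      · rw [if_pos hT]
        congr 1
        rw [eq_iff_iff]
        constructor
        · rintro rfl
          exact Finset.erase_insert hv
        · rintro rfl
          exact (Finset.insert_erase hT).symm
      · rw [if_neg hT, if_neg]
        rintro rfl
        exact hT (Finset.mem_insert_self v S)
  have h0 := layer_eq_zero_of_lower_eq_zero hi (lower_layer_eq_zero (i := i) hD)
  apply hφ
  rw [LinearMap.pi_apply_eq_sum_univ φ]
  refine Finset.sum_eq_zero fun S _ => ?_
  have hS := congrFun h0 S
  simp only [layer, Pi.zero_apply] at hS ⊢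
  split_ifs at hS ⊢ with hc
  · have : φ (fun j => if S = j then 1 else 0) = h S := by
      congr 1
      funext j
      simp [Pi.single_apply, eq_comm]
    rw [this, hS, smul_zero]
  · rw [zero_smul]

end BooleanLattice

/-! ### Maximal rank of up operators by deletion and link. -/

section SetFamily

variable {α k : Type*} [DecidableEq α] [Field k]

/-- The up operator from the `i`-sets to the `(i + 1)`-sets of the family `F` is injective. -/
def UpInjective (k : Type*) [Field k] (F : Set (Finset α)) (i : ℕ) : Prop :=
  ∀ f : Finset α → k, (∀ T ∈ F, T.card = i + 1 → ∑ v ∈ T, f (T.erase v) = 0) →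
    ∀ S ∈ F, S.card = i → f S = 0

/-- The up operator from the `i`-sets to the `(i + 1)`-sets of the family `F` is surjective. -/
def UpSurjective (k : Type*) [Field k] (F : Set (Finset α)) (i : ℕ) : Prop :=
  ∀ g : Finset α → k, ∃ f : Finset α → k, ∀ T ∈ F, T.card = i + 1 → ∑ v ∈ T, f (T.erase v) = g T

/-- The members of `F` that avoid `x`. -/
def deletion (F : Set (Finset α)) (x : α) : Set (Finset α) := {S | x ∉ S ∧ S ∈ F}

/-- The sets avoiding `x` whose union with `{x}` belongs to `F`. -/
def vertexLink (F : Set (Finset α)) (x : α) : Set (Finset α) := {S | x ∉ S ∧ insert x S ∈ F}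

theorem sum_erase_insert {x : α} {R : Finset α} (hx : x ∉ R) (f : Finset α → k) :
    ∑ v ∈ insert x R, f ((insert x R).erase v) = f R + ∑ v ∈ R, f (insert x (R.erase v)) := by
  rw [Finset.sum_insert hx, Finset.erase_insert hx]
  congr 1
  refine Finset.sum_congr rfl fun v hv => ?_
  rw [Finset.erase_insert_of_ne]
  rintro rfl
  exact hx hv

/-- A kernel element vanishes on sets avoiding `x` by the deletion. Its equations at sets `insert x
R` then lose the term `f R` and become the kernel equations of the link, one degree lower. For `i =
0` no set contains `x`, so nothing is asked of the link. -/
theorem UpInjective.of_deletion_vertexLink {F : Set (Finset α)} {x : α} {i : ℕ}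
    (hF : ∀ S, insert x S ∈ F → S ∈ F) (hd : UpInjective k (deletion F x) i)
    (hl : ∀ j, j + 1 = i → UpInjective k (vertexLink F x) j) : UpInjective k F i := by
  intro f hf
  have h1 : ∀ S ∈ F, x ∉ S → S.card = i → f S = 0 := fun S hS hx hc =>
    hd f (fun T hT => hf T hT.2) S ⟨hx, hS⟩ hc
  intro S hS hc
  by_cases hx : x ∈ S
  · have hcard := Finset.card_erase_add_one hx
    have := hl (S.erase x).card (by omega) (fun R => f (insert x R)) ?_ (S.erase x)
      ⟨Finset.notMem_erase x S, by rwa [Finset.insert_erase hx]⟩ rfl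
    · simpa only [Finset.insert_erase hx] using this
    · intro T hT hTc
      have h2 := hf _ hT.2 (by rw [Finset.card_insert_of_notMem hT.1]; omega)
      rwa [sum_erase_insert hT.1, h1 T (hF T hT.2) hT.1 (by omega), zero_add] at h2
  · exact h1 S hS hx hc

theorem UpSurjective.of_deletion_vertexLink {F : Set (Finset α)} {x : α} {i : ℕ}
    (hd : UpSurjective k (deletion F x) (i + 1))
    (hl : UpSurjective k (vertexLink F x) i) : UpSurjective k F (i + 1) := by
  intro g
  obtain ⟨f, hf⟩ := hd g
  -- The values `f` on sets avoiding `x` are already fixed and contribute `f R` at `insert x R`; the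
  -- link solves for the remainder.
  obtain ⟨h, hh⟩ := hl fun R => g (insert x R) - f R
  refine ⟨fun S => if x ∈ S then h (S.erase x) else f S, fun T hT hc => ?_⟩
  by_cases hx : x ∈ T
  · beta_reduce
    obtain ⟨R, hR, rfl⟩ : ∃ R, x ∉ R ∧ T = insert x R :=
      ⟨T.erase x, Finset.notMem_erase x T, (Finset.insert_erase hx).symm⟩
    rw [Finset.card_insert_of_notMem hR] at hc
    rw [sum_erase_insert hR fun S => if x ∈ S then h (S.erase x) else f S, if_neg hR, ← eq_sub_iff_add_eq', ← hh R ⟨hR, hT⟩ (by omega)]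
    refine Finset.sum_congr rfl fun v hv => ?_
    rw [if_pos (Finset.mem_insert_self _ _), Finset.erase_insert]
    exact fun h => hR (Finset.mem_of_mem_erase h)
  · rw [← hf T ⟨hx, hT⟩ hc]
    exact Finset.sum_congr rfl fun v hv => if_neg fun h => hx (Finset.mem_of_mem_erase h)

/-- The subsets of `V` not containing both `r` and `s`. -/
def subsetsAvoiding (V : Finset α) (r s : α) : Set (Finset α) :=
  {S | S ⊆ V ∧ ¬ (r ∈ S ∧ s ∈ S)}

theorem deletion_subsetsAvoiding (V : Finset α) (r s : α) :
    deletion (subsetsAvoiding V r s) r = {S | S ⊆ V.erase r} := by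
  ext S
  simp only [deletion, subsetsAvoiding, Set.mem_ofPred_eq, Finset.subset_erase]
  tauto

theorem vertexLink_subsetsAvoiding {V : Finset α} {r s : α} (hr : r ∈ V) (hrs : r ≠ s) :
    vertexLink (subsetsAvoiding V r s) r = {S | S ⊆ (V.erase r).erase s} := by
  ext S
  simp only [vertexLink, subsetsAvoiding, Set.mem_ofPred_eq, Finset.subset_erase,
    Finset.insert_subset_iff, Finset.mem_insert, hrs.symm]
  tauto

/-- The sets containing neither the pair `p`, `q` nor the pair `r`, `s`. -/
def avoidingPairs (p q r s : α) : Set (Finset α) :=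
  {S | ¬ (p ∈ S ∧ q ∈ S) ∧ ¬ (r ∈ S ∧ s ∈ S)}

theorem avoidingPairs_of_insert {p q r s x : α} {S : Finset α}
    (h : insert x S ∈ avoidingPairs p q r s) : S ∈ avoidingPairs p q r s :=
  ⟨fun h' => h.1 ⟨Finset.mem_insert_of_mem h'.1, Finset.mem_insert_of_mem h'.2⟩,
    fun h' => h.2 ⟨Finset.mem_insert_of_mem h'.1, Finset.mem_insert_of_mem h'.2⟩⟩

theorem avoidingPairs_swap_left {α : Type*} (p q r s : α) : avoidingPairs p q r s = avoidingPairs q p r s := by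
  ext S
  simp only [avoidingPairs, Set.mem_ofPred_eq, and_comm]

theorem avoidingPairs_swap_right {α : Type*} (p q r s : α) : avoidingPairs p q r s = avoidingPairs p q s r := by
  ext S
  simp only [avoidingPairs, Set.mem_ofPred_eq, and_comm]

variable [Fintype α] [CharZero k]

theorem upInjective_subsets {V : Finset α} {i : ℕ} (hi : 2 * i < V.card) :
    UpInjective k {S | S ⊆ V} i := by
  intro f hf S hS hc
  have := congrFun (layer_eq_zero_of_raise_eq_zero hi (raise_layer_eq_zero hf)) S
  rwa [layer, if_pos ⟨hS, hc⟩] at this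

theorem upSurjective_subsets {V : Finset α} {i : ℕ} (hi : V.card < 2 * (i + 1)) :
    UpSurjective k {S | S ⊆ V} i := by
  intro g
  obtain ⟨f, hf⟩ := layer_mem_range_raise hi g
  refine ⟨f, fun T hT hc => ?_⟩
  rw [← raise_apply_of_subset hT, hf, layer, if_pos ⟨hT, hc⟩]

/-- Splitting at `r` leaves Boolean lattices on `V.card - 1` elements in degree `i` and on `V.card -
2` elements in degree `i - 1`; the first gives the stronger bound. For surjectivity the link is the
binding one. -/
theorem upInjective_subsetsAvoiding {V : Finset α} {r s : α} (hr : r ∈ V) (hs : s ∈ V)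
    (hrs : r ≠ s) {i : ℕ} (hi : 2 * i + 1 < V.card) : UpInjective k (subsetsAvoiding V r s) i := by
  have h1 := Finset.card_erase_add_one hr
  have h2 := Finset.card_erase_add_one (Finset.mem_erase.2 ⟨hrs.symm, hs⟩)
  apply UpInjective.of_deletion_vertexLink (x := r)
  · exact fun S h => ⟨(Finset.subset_insert r S).trans h.1, fun h' =>
      h.2 ⟨Finset.mem_insert_self r S, Finset.mem_insert_of_mem h'.2⟩⟩
  · rw [deletion_subsetsAvoiding]
    exact upInjective_subsets (by omega)
  · intro j hj
    rw [vertexLink_subsetsAvoiding hr hrs]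
    exact upInjective_subsets (by omega)

theorem upSurjective_subsetsAvoiding {V : Finset α} {r s : α} (hr : r ∈ V) (hs : s ∈ V)
    (hrs : r ≠ s) {i : ℕ} (hi : V.card < 2 * (i + 1) + 2) :
    UpSurjective k (subsetsAvoiding V r s) (i + 1) := by
  have h1 := Finset.card_erase_add_one hr
  have h2 := Finset.card_erase_add_one (Finset.mem_erase.2 ⟨hrs.symm, hs⟩)
  apply UpSurjective.of_deletion_vertexLink (x := r)
  · rw [deletion_subsetsAvoiding]
    exact upSurjective_subsets (by omega)
  · rw [vertexLink_subsetsAvoiding hr hrs]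
    exact upSurjective_subsets (by omega)

theorem deletion_avoidingPairs_of_common (x q s : α) :
    deletion (avoidingPairs x q x s) x = {S | S ⊆ Finset.univ.erase x} := by
  ext S
  simp only [deletion, avoidingPairs, Set.mem_ofPred_eq, Finset.subset_erase, Finset.subset_univ]
  tauto

theorem vertexLink_avoidingPairs_of_common {x q s : α} (hq : x ≠ q) (hs : x ≠ s) :
    vertexLink (avoidingPairs x q x s) x =
      {S | S ⊆ ((Finset.univ.erase x).erase q).erase s} := by
  ext S
  simp only [vertexLink, avoidingPairs, Set.mem_ofPred_eq, Finset.subset_erase, Finset.subset_univ,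
    Finset.mem_insert, hq.symm, hs.symm]
  tauto

theorem deletion_avoidingPairs (p q r s : α) :
    deletion (avoidingPairs p q r s) p = subsetsAvoiding (Finset.univ.erase p) r s := by
  ext S
  simp only [deletion, avoidingPairs, subsetsAvoiding, Set.mem_ofPred_eq, Finset.subset_erase,
    Finset.subset_univ]
  tauto

theorem vertexLink_avoidingPairs {p q r s : α} (hpq : p ≠ q) (hpr : p ≠ r) (hps : p ≠ s) :
    vertexLink (avoidingPairs p q r s) p =
      subsetsAvoiding ((Finset.univ.erase p).erase q) r s := by
  ext S
  simp only [vertexLink, avoidingPairs, subsetsAvoiding, Set.mem_ofPred_eq, Finset.subset_erase,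
    Finset.subset_univ, Finset.mem_insert, hpq.symm, hpr.symm, hps.symm]
  tauto

theorem maximalRank_avoidingPairs_of_common {x q s : α} (hq : x ≠ q) (hs : x ≠ s) (hqs : q ≠ s)
    (h3 : 3 < Fintype.card α) (i : ℕ) :
    UpInjective k (avoidingPairs x q x s) i ∨ UpSurjective k (avoidingPairs x q x s) i := by
  have c1 := Finset.card_erase_add_one (Finset.mem_univ x)
  have c2 := Finset.card_erase_add_one (Finset.mem_erase.2 ⟨hq.symm, Finset.mem_univ q⟩)
  have c3 := Finset.card_erase_add_one (Finset.mem_erase.2 ⟨hqs.symm,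
    Finset.mem_erase.2 ⟨hs.symm, Finset.mem_univ s⟩⟩)
  rw [Finset.card_univ] at c1
  -- The blocks are Boolean lattices on `n - 1` elements in degree `i` and `n - 3` in degree `i -
  -- 1`, with `n = Fintype.card α`; their middles align, so one threshold serves both.
  by_cases hi : 2 * i + 1 < Fintype.card α
  · left
    apply UpInjective.of_deletion_vertexLink (x := x) (fun S => avoidingPairs_of_insert)
    · rw [deletion_avoidingPairs_of_common]
      exact upInjective_subsets (by omega)
    · intro j hj
      rw [vertexLink_avoidingPairs_of_common hq hs]
      exact upInjective_subsets (by omega)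
  · right
    obtain ⟨j, rfl⟩ : ∃ j, i = j + 1 := ⟨i - 1, by omega⟩
    apply UpSurjective.of_deletion_vertexLink (x := x)
    · rw [deletion_avoidingPairs_of_common]
      exact upSurjective_subsets (by omega)
    · rw [vertexLink_avoidingPairs_of_common hq hs]
      exact upSurjective_subsets (by omega)

theorem maximalRank_avoidingPairs_of_disjoint {p q r s : α} (hpq : p ≠ q) (hrs : r ≠ s)
    (hpr : p ≠ r) (hps : p ≠ s) (hqr : q ≠ r) (hqs : q ≠ s) (hodd : Odd (Fintype.card α)) (i : ℕ) :
    UpInjective k (avoidingPairs p q r s) i ∨ UpSurjective k (avoidingPairs p q r s) i := by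
  obtain ⟨m, hm⟩ := hodd
  have h4 : 4 ≤ Fintype.card α := by
    have := Finset.card_le_univ ({p, q, r, s} : Finset α)
    have hc : ({p, q, r, s} : Finset α).card = 4 := by
      rw [Finset.card_insert_of_notMem, Finset.card_insert_of_notMem, Finset.card_pair hrs] <;>
        simp [*]
    omega
  have c1 := Finset.card_erase_add_one (Finset.mem_univ p)
  have c2 := Finset.card_erase_add_one (Finset.mem_erase.2 ⟨hpq.symm, Finset.mem_univ q⟩)
  rw [Finset.card_univ] at c1
  have hr : r ∈ Finset.univ.erase p := by simp [hpr.symm]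
  have hs : s ∈ Finset.univ.erase p := by simp [hps.symm]
  have hr' : r ∈ (Finset.univ.erase p).erase q := by simp [hpr.symm, hqr.symm]
  have hs' : s ∈ (Finset.univ.erase p).erase q := by simp [hps.symm, hqs.symm]
  -- The deletion is injective in this range, while the link is surjective only for `Fintype.card α
  -- < 2 * i + 2`. Parity rules out equality.
  by_cases hi : 2 * i + 2 < Fintype.card α
  · left
    apply UpInjective.of_deletion_vertexLink (x := p) (fun S => avoidingPairs_of_insert)
    · rw [deletion_avoidingPairs]
      exact upInjective_subsetsAvoiding hr hs hrs (by omega)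
    · intro j hj
      rw [vertexLink_avoidingPairs hpq hpr hps]
      exact upInjective_subsetsAvoiding hr' hs' hrs (by omega)
  · right
    -- An odd cardinality that is at least `4` is at least `5`, which forces `i ≥ 2` here.
    obtain ⟨j, rfl⟩ : ∃ j, i = j + 2 := ⟨i - 2, by omega⟩
    apply UpSurjective.of_deletion_vertexLink (x := p)
    · rw [deletion_avoidingPairs]
      exact upSurjective_subsetsAvoiding hr hs hrs (by omega)
    · rw [vertexLink_avoidingPairs hpq hpr hps]
      exact upSurjective_subsetsAvoiding hr' hs' hrs (by omega)

theorem maximalRank_avoidingPairs {p q r s : α} (hpq : p ≠ q) (hrs : r ≠ s)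
    (h1 : ¬ (p = r ∧ q = s)) (h2 : ¬ (p = s ∧ q = r)) (h3 : 3 < Fintype.card α)
    (hodd : Odd (Fintype.card α)) (i : ℕ) :
    UpInjective k (avoidingPairs p q r s) i ∨ UpSurjective k (avoidingPairs p q r s) i := by
  by_cases hpr : p = r
  · subst hpr
    exact maximalRank_avoidingPairs_of_common hpq hrs (by tauto) h3 i
  by_cases hps : p = s
  · subst hps
    rw [avoidingPairs_swap_right]
    exact maximalRank_avoidingPairs_of_common hpq hrs.symm (by tauto) h3 i
  by_cases hqr : q = r
  · subst hqr
    rw [avoidingPairs_swap_left]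
    exact maximalRank_avoidingPairs_of_common hpq.symm hrs (by tauto) h3 i
  by_cases hqs : q = s
  · subst hqs
    rw [avoidingPairs_swap_left, avoidingPairs_swap_right]
    exact maximalRank_avoidingPairs_of_common hpq.symm hrs.symm (by tauto) h3 i
  exact maximalRank_avoidingPairs_of_disjoint hpq hrs hpr hps hqr hqs hodd i

end SetFamily

/-! ### From quadratic monomial ideals to families of sets. -/

section MonomialQuotient

variable {k : Type*} [Field k] {n : ℕ}

/-- The exponent vector of the squarefree monomial with support `S`. -/
def squarefreeExponent (S : Finset (Fin n)) : Fin n →₀ ℕ :=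
  Finsupp.equivFunOnFinite.symm fun v => if v ∈ S then 1 else 0

theorem squarefreeExponent_apply (S : Finset (Fin n)) (v : Fin n) :
    squarefreeExponent S v = if v ∈ S then 1 else 0 := rfl

theorem squarefreeExponent_injective :
    Function.Injective (squarefreeExponent : Finset (Fin n) → Fin n →₀ ℕ) := by
  intro S T h
  ext v
  have := DFunLike.congr_fun h v
  simp only [squarefreeExponent_apply] at this
  by_cases hS : v ∈ S <;> by_cases hT : v ∈ T <;> simp_all

theorem degree_squarefreeExponent (S : Finset (Fin n)) :
    (squarefreeExponent S).degree = S.card := by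
  simp [Finsupp.degree_eq_sum, squarefreeExponent_apply]

theorem squarefreeExponent_sub_single (S : Finset (Fin n)) (v : Fin n) :
    squarefreeExponent S - Finsupp.single v 1 = squarefreeExponent (S.erase v) := by
  ext w
  rw [Finsupp.tsub_apply, squarefreeExponent_apply, squarefreeExponent_apply, Finsupp.single_apply]
  by_cases h : v = w
  · subst h
    by_cases hv : v ∈ S <;> simp [hv]
  · simp [h, Ne.symm h]

theorem coeff_squarefreeExponent_sum_X_mul (T : Finset (Fin n)) (p : MvPolynomial (Fin n) k) :
    coeff (squarefreeExponent T) ((∑ j, X j) * p) =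
      ∑ v ∈ T, coeff (squarefreeExponent (T.erase v)) p := by
  rw [Finset.sum_mul, coeff_sum, ← Finset.sum_subset (Finset.subset_univ T)]
  · refine Finset.sum_congr rfl fun v hv => ?_
    rw [coeff_X_mul', if_pos (by simp [squarefreeExponent_apply, hv]),
      squarefreeExponent_sub_single]
  · intro v _ hv
    rw [coeff_X_mul', if_neg (by simp [squarefreeExponent_apply, hv])]

/-- The supports of the squarefree monomials divisible by no monomial of `G`. -/
def standardSupports (G : Finset (Fin n →₀ ℕ)) : Set (Finset (Fin n)) :=
  {S | ∀ m ∈ G, ¬ m ≤ squarefreeExponent S}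

/-- Membership in a monomial ideal is tested monomial by monomial, and every non-squarefree monomial
is divisible by some square in `G`. -/
theorem mem_monomialIdeal_iff {G : Finset (Fin n →₀ ℕ)} (hG : ∀ j, Finsupp.single j 2 ∈ G)
    (p : MvPolynomial (Fin n) k) :
    p ∈ monomialIdeal k G ↔ ∀ S ∈ standardSupports G, coeff (squarefreeExponent S) p = 0 := by
  rw [monomialIdeal, mem_ideal_span_monomial_image]
  constructor
  · intro h S hS
    by_contra hc
    obtain ⟨m, hm, hle⟩ := h _ (mem_support_iff.2 hc)
    exact hS m hm hle
  · intro h d hd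
    by_contra! hc
    have hd1 : ∀ j, d j ≤ 1 := by
      intro j
      by_contra! hj
      exact hc _ (hG j) (Finsupp.single_le_iff.2 hj)
    have hds : squarefreeExponent d.support = d := by
      ext j
      rw [squarefreeExponent_apply]
      have := hd1 j
      split_ifs with hj <;> simp only [Finsupp.mem_support_iff] at hj <;> omega
    refine mem_support_iff.1 hd ?_
    rw [← hds]
    exact h _ fun m hm hle => hc m hm (hds ▸ hle)

theorem sum_X_mem_quotPiece (I : Ideal (MvPolynomial (Fin n) k)) :
    Ideal.Quotient.mk I (∑ j, X j) ∈ quotPiece I 1 :=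
  ⟨∑ j, X j, IsHomogeneous.sum _ _ _ fun j _ => isHomogeneous_X k j, rfl⟩

theorem hasWLP_of_maximalRank {G : Finset (Fin n →₀ ℕ)} (hG : ∀ j, Finsupp.single j 2 ∈ G)
    (h : ∀ i, UpInjective k (standardSupports G) i ∨ UpSurjective k (standardSupports G) i) :
    HasWLP (monomialIdeal k G) := by
  refine ⟨_, sum_X_mem_quotPiece _, fun i => (h i).imp (fun hi => ?_) (fun hs => ?_)⟩
  · rw [injective_iff_map_eq_zero]
    rintro ⟨_, p, hp, rfl⟩ h0
    have h1 : (∑ j, X j) * p ∈ monomialIdeal k G := by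
      rw [← Ideal.Quotient.eq_zero_iff_mem, map_mul]
      exact congrArg Subtype.val h0
    rw [mem_monomialIdeal_iff hG] at h1
    apply Subtype.ext
    refine Ideal.Quotient.eq_zero_iff_mem.2 ((mem_monomialIdeal_iff hG p).2 fun S hS => ?_)
    by_cases hc : S.card = i
    · refine hi (fun S => coeff (squarefreeExponent S) p) (fun T hT _ => ?_) S hS hc
      rw [← coeff_squarefreeExponent_sum_X_mul]
      exact h1 T hT
    · refine IsHomogeneous.coeff_eq_zero hp ?_
      rwa [degree_squarefreeExponent]
  · rintro ⟨_, q, hq, rfl⟩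
    obtain ⟨f, hf⟩ := hs fun S => coeff (squarefreeExponent S) q
    set p : MvPolynomial (Fin n) k :=
      ∑ S with S.card = i, monomial (squarefreeExponent S) (f S) with hpdef
    have hp : p.IsHomogeneous i := IsHomogeneous.sum _ _ _ fun S hS =>
      isHomogeneous_monomial _ (by
        rw [degree_squarefreeExponent]
        exact (Finset.mem_filter.1 hS).2)
    have hpc : ∀ S : Finset (Fin n), S.card = i → coeff (squarefreeExponent S) p = f S := by
      intro S hS
      simp only [hpdef, coeff_sum, coeff_monomial, squarefreeExponent_injective.eq_iff]
      simp [hS]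
    refine ⟨⟨Ideal.Quotient.mk _ p, p, hp, rfl⟩, Subtype.ext ?_⟩
    change Ideal.Quotient.mk _ (∑ j, X j) * Ideal.Quotient.mk _ p = Ideal.Quotient.mk _ q
    rw [← map_mul, Ideal.Quotient.eq, mem_monomialIdeal_iff hG]
    intro T hT
    rw [coeff_sub, sub_eq_zero, coeff_squarefreeExponent_sum_X_mul]
    by_cases hc : T.card = i + 1
    · rw [← hf T hT hc]
      refine Finset.sum_congr rfl fun v hv => hpc _ ?_
      rw [Finset.card_erase_of_mem hv, hc, Nat.add_sub_cancel]
    · rw [IsHomogeneous.coeff_eq_zero hq (by rwa [degree_squarefreeExponent])]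
      refine Finset.sum_eq_zero fun v hv => IsHomogeneous.coeff_eq_zero hp ?_
      rw [degree_squarefreeExponent]
      have := Finset.card_erase_add_one hv
      omega

/-- The descending chain of ideals generated by powers of `X j` stabilises, so the ideal contains
some `X j ^ (N + 1) * q - X j ^ N`. The monomial `X j ^ N` occurs in it, so a generator divides that
power; having degree `2`, it is the square of `X j`. -/
theorem single_two_mem_of_isArtinianRing {G : Finset (Fin n →₀ ℕ)} (hdeg : ∀ m ∈ G, m.degree = 2)
    (hart : IsArtinianRing (MvPolynomial (Fin n) k ⧸ monomialIdeal k G)) (j : Fin n) :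
    Finsupp.single j 2 ∈ G := by
  obtain ⟨N, y, hy⟩ := IsArtinian.exists_pow_succ_smul_dvd
    (Ideal.Quotient.mk (monomialIdeal k G) (X j)) (1 : MvPolynomial (Fin n) k ⧸ monomialIdeal k G)
  obtain ⟨q, rfl⟩ := Ideal.Quotient.mk_surjective y
  rw [smul_eq_mul, smul_eq_mul, mul_one, ← map_pow, ← map_pow, ← map_mul, Ideal.Quotient.eq,
    monomialIdeal, mem_ideal_span_monomial_image] at hy
  obtain ⟨m, hm, hle⟩ := hy (Finsupp.single j N) (by
    rw [mem_support_iff, coeff_sub, X_pow_eq_monomial, X_pow_eq_monomial, coeff_monomial_mul',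
      if_neg, coeff_monomial, if_pos rfl]
    · simp
    · intro h
      simpa using h j)
  have hm' : m = Finsupp.single j (m j) := by
    ext w
    by_cases hw : j = w
    · subst hw
      simp
    · simpa [Finsupp.single_apply, hw] using hle w
  have h2 := hdeg m hm
  rw [hm', Finsupp.degree_single] at h2
  rwa [hm', h2] at hm

theorem exists_eq_single_add_single {m : Fin n →₀ ℕ} (hm : m.degree = 2) :
    ∃ p q, m = Finsupp.single p 1 + Finsupp.single q 1 := by
  obtain ⟨p, hp⟩ : ∃ p, m p ≠ 0 := by
    by_contra! h
    rw [show m = 0 from Finsupp.ext h] at hm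
    simp at hm
  obtain ⟨m', rfl⟩ := exists_add_of_le (Finsupp.single_le_iff.2 (Nat.one_le_iff_ne_zero.2 hp))
  rw [map_add, Finsupp.degree_single] at hm
  obtain ⟨q, hq⟩ : ∃ q, m' q ≠ 0 := by
    by_contra! h
    rw [show m' = 0 from Finsupp.ext h] at hm
    simp at hm
  obtain ⟨m'', rfl⟩ := exists_add_of_le (Finsupp.single_le_iff.2 (Nat.one_le_iff_ne_zero.2 hq))
  rw [map_add, Finsupp.degree_single] at hm
  have h0 : m''.degree = 0 := by omega
  rw [Finsupp.degree_eq_zero_iff] at h0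
  exact ⟨p, q, by rw [h0, add_zero]⟩

theorem single_add_single_le_squarefreeExponent {p q : Fin n} (hpq : p ≠ q) (S : Finset (Fin n)) :
    Finsupp.single p 1 + Finsupp.single q 1 ≤ squarefreeExponent S ↔ p ∈ S ∧ q ∈ S := by
  constructor
  · intro h
    have hp := h p
    have hq := h q
    simp only [Finsupp.add_apply, Finsupp.single_eq_same, Finsupp.single_apply, hpq, hpq.symm,
      squarefreeExponent_apply] at hp hq
    constructor <;> by_contra hc <;> simp [hc] at hp hq
  · rintro ⟨hp, hq⟩ w
    rw [Finsupp.add_apply, Finsupp.single_apply, Finsupp.single_apply, squarefreeExponent_apply]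
    by_cases h1 : p = w
    · subst h1
      simp [hp, hpq.symm]
    · by_cases h2 : q = w
      · subst h2
        simp [hq, h1]
      · simp [h1, h2]

theorem exists_standardSupports_eq_avoidingPairs {G : Finset (Fin n →₀ ℕ)} (hcard : G.card = n + 2)
    (hdeg : ∀ m ∈ G, m.degree = 2) (hG : ∀ j, Finsupp.single j 2 ∈ G) :
    ∃ p q r s : Fin n, p ≠ q ∧ r ≠ s ∧ ¬ (p = r ∧ q = s) ∧ ¬ (p = s ∧ q = r) ∧
      standardSupports G = avoidingPairs p q r s := by
  set Q : Finset (Fin n →₀ ℕ) := Finset.univ.image fun j => Finsupp.single j 2 with hQ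
  have hQG : Q ⊆ G := by
    intro m hm
    obtain ⟨j, -, rfl⟩ := Finset.mem_image.1 hm
    exact hG j
  have hQc : Q.card = n := by
    rw [hQ, Finset.card_image_of_injective _ (Finsupp.single_left_injective two_ne_zero),
      Finset.card_univ, Fintype.card_fin]
  have h2 : (G \ Q).card = 2 := by
    rw [Finset.card_sdiff_of_subset hQG]
    omega
  obtain ⟨a, b, hab, hGQ⟩ := Finset.card_eq_two.1 h2
  have key : ∀ m ∈ G \ Q, ∃ p q, p ≠ q ∧ m = Finsupp.single p 1 + Finsupp.single q 1 := by
    intro m hm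
    rw [Finset.mem_sdiff] at hm
    obtain ⟨p, q, rfl⟩ := exists_eq_single_add_single (hdeg m hm.1)
    refine ⟨p, q, ?_, rfl⟩
    rintro rfl
    refine hm.2 (Finset.mem_image.2 ⟨p, Finset.mem_univ p, ?_⟩)
    rw [← Finsupp.single_add]
  obtain ⟨p, q, hpq, rfl⟩ := key a (by simp [hGQ])
  obtain ⟨r, s, hrs, rfl⟩ := key b (by simp [hGQ])
  refine ⟨p, q, r, s, hpq, hrs, ?_, ?_, ?_⟩
  · rintro ⟨rfl, rfl⟩
    exact hab rfl
  · rintro ⟨rfl, rfl⟩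
    -- Reversed pairs give the same monomial, so the two edges differ as unordered pairs.
    exact hab (add_comm _ _)
  · ext S
    rw [standardSupports, avoidingPairs, Set.mem_ofPred_eq, Set.mem_ofPred_eq,
      ← single_add_single_le_squarefreeExponent hpq,
      ← single_add_single_le_squarefreeExponent hrs]
    constructor
    · intro h
      have hsub : ∀ m ∈ G \ Q, m ∈ G := fun m hm => (Finset.mem_sdiff.1 hm).1
      exact ⟨h _ (hsub _ (by simp [hGQ])), h _ (hsub _ (by simp [hGQ]))⟩
    · rintro ⟨h1, h2⟩ m hm
      by_cases hmQ : m ∈ Q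
      · obtain ⟨j, -, rfl⟩ := Finset.mem_image.1 hmQ
        intro hle
        have := hle j
        rw [Finsupp.single_eq_same, squarefreeExponent_apply] at this
        split_ifs at this <;> omega
      · have : m ∈ G \ Q := Finset.mem_sdiff.2 ⟨hm, hmQ⟩
        rw [hGQ, Finset.mem_insert, Finset.mem_singleton] at this
        rcases this with rfl | rfl
        · exact h1
        · exact h2

end MonomialQuotient

end

theorem proposition6p5 {k : Type*} [Field k] [CharZero k] (n : ℕ) (hn : 5 ≤ n) (hodd : Odd n)
    (I : Ideal (MvPolynomial (Fin n) k))
    (hart : IsArtinianRing (MvPolynomial (Fin n) k ⧸ I))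
    (hI : IsMinGenByMonomials I (n + 2) 2) :
    HasWLP I := by
  obtain ⟨G, hcard, hdeg, rfl, -⟩ := hI
  have hG := single_two_mem_of_isArtinianRing hdeg hart
  obtain ⟨p, q, r, s, hpq, hrs, h1, h2, hF⟩ :=
    exists_standardSupports_eq_avoidingPairs hcard hdeg hG
  refine hasWLP_of_maximalRank hG fun i => ?_
  rw [hF]
  exact maximalRank_avoidingPairs hpq hrs h1 h2 (by rw [Fintype.card_fin]; omega)
    (by rwa [Fintype.card_fin]) i
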